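/- Let $p$ be a prime, let $k$ be a field of characteristic $p$, and let $n \ge 0$. Let $G$ be a finite subgroup of $\mathrm{GL}_n(k) = \mathrm{GL}(V)$, $V = k^n$, such that $V$ is a completely reducible $kG$-module (every $G$-invariant subspace has a $G$-invariant complement). Suppose that $G$ is $p$-solvable, i.e. every composition factor of $G$ either has order $p$ or has order prime to $p$. If $p$ divides $|G|$, then either $n \ge p$, or $n = p-1$ and $p$ is a Fermat prime (a prime of the form $2^{2^m}+1$ with $m \ge 0$). -/

import Mathlib

/-- `CompositionStep G` relates `K` to `H` when `K` is contained in `H`, is normal in `H`, and the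
quotient `H / K` is a (nontrivial) simple group. -/
def CompositionStep (G : Type*) [Group G] : SetRel (Subgroup G) (Subgroup G) :=
  {x | x.1 ≤ x.2 ∧ ∃ _ : (x.1.subgroupOf x.2).Normal, IsSimpleGroup (x.2 ⧸ x.1.subgroupOf x.2)}

/-- A composition series of `G`: a chain `1 = H₀ ≤ H₁ ≤ ⋯ ≤ Hₘ = G` in which every term is normal
in the next one, with simple quotient. -/
structure GroupCompositionSeries (G : Type*) [Group G] extends RelSeries (CompositionStep G) where
  head_eq_bot : toRelSeries.head = ⊥
  last_eq_top : toRelSeries.last = ⊤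

/-- A finite group `G` is `p`-solvable if every composition factor `Hᵢ₊₁ / Hᵢ` of `G` either has
order `p` or has order prime to `p`. -/
def IsPSolvable (p : ℕ) (G : Type*) [Group G] : Prop :=
  ∀ (s : GroupCompositionSeries G) (i : Fin s.length),
    Nat.card (s.toFun i.succ ⧸ (s.toFun i.castSucc).subgroupOf (s.toFun i.succ)) = p ∨
      (Nat.card (s.toFun i.succ ⧸ (s.toFun i.castSucc).subgroupOf (s.toFun i.succ))).Coprime p

/-- The natural representation of a subgroup `G` of `GL_n(k)` on the column space `V = kⁿ`:
`g` acts by `v ↦ g *ᵥ v`. -/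
def naturalRep {k : Type*} [Field k] {n : ℕ} (G : Subgroup (Matrix.GeneralLinearGroup (Fin n) k)) :
    Representation k G (Fin n → k) :=
  ((Matrix.toLinAlgEquiv' : Matrix (Fin n) (Fin n) k ≃ₐ[k] _) : _ →* _).comp
    ((Units.coeHom (Matrix (Fin n) (Fin n) k)).comp G.subtype)

/-- A subgroup of `GL_n(k)` is completely reducible if `V = kⁿ` is a completely reducible
(semisimple) `kG`-module: every `G`-invariant subspace has a `G`-invariant complement. -/
def IsCompletelyReducible {k : Type*} [Field k] {n : ℕ}
    (G : Subgroup (Matrix.GeneralLinearGroup (Fin n) k)) : Prop :=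
  (naturalRep G).IsSemisimpleRepresentation

/-- A Fermat prime is a prime of the form `2 ^ (2 ^ m) + 1`. -/
def IsFermatPrime (p : ℕ) : Prop :=
  p.Prime ∧ ∃ m : ℕ, p = Nat.fermatNumber m

/-! Assume `n < p`. Complete reducibility forces every normal `p`-subgroup of `G` to be trivial, so
`p`-solvability yields a normal `p'`-subgroup `Q` containing its own centralizer (Hall–Higman). An
element `x` of order `p` therefore acts nontrivially on `Q`, hence on some `x`-invariant
`q`-subgroup `S` of `Q`.

Over the algebraic closure `K`, the algebra `K[S]` is a product of matrix algebras, permuted by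
conjugation by `x`. Some block of degree `d ≤ n` survives in `V` and is moved by `x` elementwise. It
is stable as a block, since otherwise its `p` conjugates would give `p` nonzero orthogonal
idempotents on a space of dimension `n < p`. On this block `x` acts as conjugation by a matrix `u ≠
1` with `u ^ p = 1`; put `N = u - 1`, nilpotent and nonzero.

The crux is `p - 1 ≤ d` (`exists_span_eq_top_of_conj_ne`). The function `s ↦ tr(N π(s))` is constant
on `x`-orbits of `S` and vanishes at fixed points, where `N π(s)` is nilpotent. So `tr(N c) = 0` for
every `c` in the block whose coefficients sum to zero along `x`-orbits taken `p` steps. If `d ≤ p -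
2`, a suitable `c` violates this (`exists_sum_conj_eq_zero_trace_ne_zero`).

Hence `d = n = p - 1`. As `d` is the degree of an absolutely irreducible representation of a
`q`-group, it divides a power of `q` (`finrank_dvd_card_of_span_eq_top`). Since `d ≥ 2`, `p` is odd,
so `q = 2` and `p` is a Fermat prime. -/

/-! ### Composition series through prescribed subgroups -/

theorem exists_relSeries_of_reflTransGen {α : Type*} {r : SetRel α α} {a b : α}
    (h : Relation.ReflTransGen (fun x y => (x, y) ∈ r) a b) :
    ∃ s : RelSeries r, s.head = a ∧ s.last = b := by
  induction h with
  | refl => exact ⟨RelSeries.singleton r a, rfl, rfl⟩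
  | @tail b c hab hbc ih =>
    obtain ⟨s, hs, hl⟩ := ih
    refine ⟨s.snoc c (by rw [hl]; exact hbc), ?_, ?_⟩
    · simpa using hs
    · simp

/-- A maximal proper normal subgroup of `B` above `A` gives a simple top factor; induct downwards on
`B`. -/
theorem reflTransGen_compositionStep {G : Type*} [Group G] [Finite G] {A B : Subgroup G}
    (hAB : A ≤ B) (hn : (A.subgroupOf B).Normal) :
    Relation.ReflTransGen (fun H K => (H, K) ∈ CompositionStep G) A B := by
  induction B using WellFoundedLT.induction with
  | _ B ih =>
    rcases eq_or_lt_of_le hAB with rfl | hlt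
    · exact .refl
    obtain ⟨M, hM⟩ := (Set.toFinite
      {M : Subgroup G | A ≤ M ∧ M < B ∧ (M.subgroupOf B).Normal}).exists_maximal ⟨A, le_rfl, hlt, hn⟩
    obtain ⟨hAM, hMB, hMn⟩ := hM.prop
    have hstep : (M, B) ∈ CompositionStep G := by
      refine ⟨hMB.le, hMn, ?_⟩
      have : Nontrivial (B ⧸ M.subgroupOf B) := by
        rw [QuotientGroup.nontrivial_iff, Ne, Subgroup.subgroupOf_eq_top]
        exact hMB.not_ge
      refine ⟨fun N hN => ?_⟩
      set N₁ := N.comap (QuotientGroup.mk' (M.subgroupOf B)) with hN₁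
      have hNmap : N = N₁.map (QuotientGroup.mk' _) :=
        (Subgroup.map_comap_eq_self_of_surjective (QuotientGroup.mk'_surjective _) _).symm
      have h1 : (N₁.map B.subtype).subgroupOf B = N₁ :=
        Subgroup.comap_map_eq_self_of_injective B.subtype_injective _
      have h2 : N₁.map B.subtype ≤ B := Subgroup.map_subtype_le _
      have h3 : M ≤ N₁.map B.subtype := by
        intro x hx
        refine ⟨⟨x, hMB.le hx⟩, ?_, rfl⟩
        have : QuotientGroup.mk' (M.subgroupOf B) ⟨x, hMB.le hx⟩ = 1 := by
          rw [QuotientGroup.mk'_apply, QuotientGroup.eq_one_iff]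
          exact hx
        rw [SetLike.mem_coe, hN₁, Subgroup.mem_comap, this]
        exact one_mem _
      rcases eq_or_lt_of_le h2 with h4 | h4
      · right
        have : N₁ = ⊤ := by rw [← h1, h4, Subgroup.subgroupOf_self]
        rw [hNmap, this]
        exact Subgroup.map_top_of_surjective _ (QuotientGroup.mk'_surjective _)
      · left
        have h5 : N₁.map B.subtype ≤ M :=
          hM.le_of_ge ⟨hAM.trans h3, h4, by rw [h1]; exact hN.comap _⟩ h3
        have h6 : N₁ ≤ M.subgroupOf B := by
          rw [← h1]; exact Subgroup.comap_mono h5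
        rw [hNmap, eq_bot_iff, Subgroup.map_le_iff_le_comap]
        simpa [MonoidHom.comap_bot] using h6
    refine .tail (ih M hMB hAM ?_) hstep
    rw [Subgroup.normal_subgroupOf_iff hAM]
    rw [Subgroup.normal_subgroupOf_iff hAB] at hn
    exact fun h k hh hk => hn h k hh (hMB.le hk)

theorem IsPSolvable.relIndex_eq_or_coprime {G : Type*} [Group G] {p : ℕ} (h : IsPSolvable p G)
    {M L : Subgroup G} (hML : (M, L) ∈ CompositionStep G)
    (h₁ : Relation.ReflTransGen (fun H K => (H, K) ∈ CompositionStep G) ⊥ M)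
    (h₂ : Relation.ReflTransGen (fun H K => (H, K) ∈ CompositionStep G) L ⊤) :
    M.relIndex L = p ∨ (M.relIndex L).Coprime p := by
  obtain ⟨s, hs, hsl⟩ := exists_relSeries_of_reflTransGen h₁
  obtain ⟨t, ht, htl⟩ := exists_relSeries_of_reflTransGen h₂
  have hst : (s.last, t.head) ∈ CompositionStep G := by rw [hsl, ht]; exact hML
  let c : GroupCompositionSeries G :=
    { s.append t hst with
      head_eq_bot := (RelSeries.head_append s t hst).trans hs
      last_eq_top := (RelSeries.last_append s t hst).trans htl }
  have key := h c ⟨s.length, by simp [c]⟩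
  have e₁ : c.toFun (Fin.castSucc ⟨s.length, by simp [c]⟩) = M := by
    rw [← hsl]
    exact RelSeries.append_apply_left s t hst (Fin.last _)
  have e₂ : c.toFun (Fin.succ ⟨s.length, by simp [c]⟩) = L := by
    rw [← ht]
    exact RelSeries.append_apply_right s t hst 0
  rw [e₁, e₂] at key
  exact key

/-! ### A self-centralizing normal `p'`-subgroup -/

/-- Take `Q` a maximal normal `p'`-subgroup and `C` its centralizer. If `C` is not inside `Q`,
choose `L` normal in `G`, minimal above `Z = C ⊓ Q` inside `C`. According to the top composition
factor of `L` over `Z`, either `L` has a nontrivial normal Sylow `p`-subgroup or `L` is a `p'`-group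
and enlarges `Q`. -/
theorem exists_normal_centralizer_le {G : Type*} [Group G] [Finite G] {p : ℕ} (hp : p.Prime)
    (hsolv : IsPSolvable p G) (hP : ∀ P : Subgroup G, P.Normal → IsPGroup p P → P = ⊥) :
    ∃ Q : Subgroup G, Q.Normal ∧ ¬ p ∣ Nat.card Q ∧ Subgroup.centralizer (Q : Set G) ≤ Q := by
  have : Fact p.Prime := ⟨hp⟩
  obtain ⟨Q, hQ⟩ := (Set.toFinite {Q : Subgroup G | Q.Normal ∧ ¬ p ∣ Nat.card Q}).exists_maximal
    ⟨⊥, inferInstance, by simpa using hp.one_lt.ne'⟩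
  obtain ⟨hQn, hQp⟩ := hQ.prop
  refine ⟨Q, hQn, hQp, ?_⟩
  by_contra hC
  set C := Subgroup.centralizer (Q : Set G) with hCdef
  set Z := C ⊓ Q with hZ
  have hZC : Z < C := lt_of_le_of_ne inf_le_left fun h => hC (inf_eq_left.mp h)
  obtain ⟨L, hL⟩ := (Set.toFinite {L : Subgroup G | L.Normal ∧ Z < L ∧ L ≤ C}).exists_minimal
    ⟨C, inferInstance, hZC, le_rfl⟩
  obtain ⟨hLn, hZL, hLC⟩ := hL.prop
  have hchain := reflTransGen_compositionStep hZL.le (inferInstance : (Z.subgroupOf L).Normal)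
  obtain ⟨M, hZM, hML⟩ := (Relation.ReflTransGen.cases_tail hchain).resolve_left hZL.ne'
  have hZM' : Z ≤ M := by
    clear hML
    induction hZM with
    | refl => exact le_rfl
    | tail _ h ih => exact ih.trans h.1
  obtain ⟨hMLle, hMn, hMs⟩ := id hML
  have hMlt : M < L := by
    refine lt_of_le_of_ne hMLle ?_
    rintro rfl
    have := hMs.toNontrivial
    rw [QuotientGroup.nontrivial_iff, Ne, Subgroup.subgroupOf_self] at this
    exact this rfl
  have hfac := hsolv.relIndex_eq_or_coprime hML
    ((reflTransGen_compositionStep bot_le inferInstance).trans hZM)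
    (reflTransGen_compositionStep le_top inferInstance)
  -- By minimality of `L`, a conjugation-invariant subset of `M` lies in `Z`. Knowing the single
  -- factor `L / M` is then enough, with no need for the structure of chief factors.
  have hmin : ∀ s : Set G, s ⊆ M → (∀ g x, x ∈ s → g * x * g⁻¹ ∈ s) → s ⊆ Z := by
    intro s hs hconj
    have h1 : Subgroup.normalClosure s ≤ M := by
      rw [Subgroup.normalClosure, Subgroup.closure_le]
      intro y hy
      obtain ⟨x, hx, hxy⟩ := Group.mem_conjugatesOfSet_iff.mp hy
      obtain ⟨c, rfl⟩ := isConj_iff.mp hxy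
      exact hs (hconj c x hx)
    have h2 : Z ⊔ Subgroup.normalClosure s ≤ M := sup_le hZM' h1
    by_contra hsZ
    have h3 : Z < Z ⊔ Subgroup.normalClosure s := by
      refine lt_of_le_of_ne le_sup_left fun h => hsZ ?_
      exact Subgroup.subset_normalClosure.trans
        (SetLike.coe_subset_coe.mpr (sup_eq_left.mp h.symm))
    have := hL.le_of_le ⟨inferInstance, h3, h2.trans (hMlt.le.trans hLC)⟩ (h2.trans hMlt.le)
    exact (this.trans h2).not_gt hMlt
  have hpow : ∀ g ∈ L, g ^ M.relIndex L ∈ M := by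
    intro g hg
    have := Subgroup.pow_index_mem (M.subgroupOf L) ⟨g, hg⟩
    exact this
  have hmemM : ∀ g ∈ L, (M.relIndex L).Coprime (orderOf g) → g ∈ M := by
    intro g hg hco
    obtain ⟨m, hm⟩ := exists_pow_eq_self_of_coprime hco
    rw [← hm]
    exact pow_mem (hpow g hg) m
  have horder : ∀ g x : G, orderOf (g * x * g⁻¹) = orderOf x := by
    intro g x
    exact orderOf_injective (MulAut.conj g).toMonoidHom (MulAut.conj g).injective x
  rcases hfac with hfac | hfac
  -- Factor of order `p`: the `p'`-elements of `L` lie in `Z`, so `L / Z` is a `p`-group; as `Z` is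
  -- central in `L`, `L` is nilpotent.
  · have hs : {g | g ∈ L ∧ p.Coprime (orderOf g)} ⊆ (Z : Set G) := by
      refine hmin _ ?_ ?_
      · rintro g ⟨hg, hco⟩
        exact hmemM g hg (by rwa [hfac])
      · rintro g x ⟨hx, hco⟩
        exact ⟨hLn.conj_mem x hx g, by rwa [horder]⟩
    have hLZ : IsPGroup p (L ⧸ Z.subgroupOf L) := by
      intro y
      obtain ⟨⟨g, hg⟩, rfl⟩ := QuotientGroup.mk_surjective y
      obtain ⟨e, m, hm, he⟩ := Nat.exists_eq_pow_mul_and_not_dvd (orderOf_pos g).ne' p hp.one_lt.ne'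
      refine ⟨e, ?_⟩
      rw [← QuotientGroup.mk_pow, QuotientGroup.eq_one_iff]
      refine hs ⟨pow_mem hg _, ?_⟩
      have : orderOf (g ^ p ^ e) = m := by
        rw [orderOf_pow_of_dvd (pow_pos hp.pos e).ne' (he ▸ Dvd.intro _ rfl), he]
        exact Nat.mul_div_cancel_left _ (pow_pos hp.pos e)
      change p.Coprime (orderOf (g ^ p ^ e))
      rw [this]
      exact (hp.coprime_iff_not_dvd).mpr hm
    have := hLZ.isNilpotent
    have hLnil : Group.IsNilpotent L := by
      refine Subgroup.isNilpotent_of_ker_le_center (QuotientGroup.mk' (Z.subgroupOf L)) ?_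
      rw [QuotientGroup.ker_mk']
      intro z hz
      rw [Subgroup.mem_center_iff]
      intro g
      have hg := hLC g.2
      rw [hCdef, Subgroup.mem_centralizer_iff] at hg
      exact Subtype.ext (hg z.1 hz.2).symm
    let S : Sylow p L := default
    have htfae := (Group.isNilpotent_of_finite_tfae (G := L)).out 0 3
    have hSn : (S : Subgroup L).Normal := htfae.mp hLnil p ‹_› S
    have := S.characteristic_of_normal hSn
    have hbot := hP ((S : Subgroup L).map L.subtype) inferInstance (S.isPGroup'.map _)
    rw [Subgroup.map_eq_bot_iff_of_injective _ L.subtype_injective] at hbot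
    refine S.ne_bot_of_dvd_card ?_ hbot
    rw [← hfac]
    exact Subgroup.index_dvd_card _
  -- Factor of order prime to `p`: elements of order `p` in `L` would lie in `Z ≤ Q`, so there are
  -- none and `Q ⊔ L` is again a `p'`-group.
  · have hs : {g | g ∈ L ∧ orderOf g = p} ⊆ (Z : Set G) := by
      refine hmin _ ?_ ?_
      · rintro g ⟨hg, hco⟩
        exact hmemM g hg (by rwa [hco])
      · rintro g x ⟨hx, hco⟩
        exact ⟨hLn.conj_mem x hx g, by rwa [horder]⟩
    have hpL : ¬ p ∣ Nat.card L := by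
      intro h
      obtain ⟨x, hx⟩ := exists_prime_orderOf_dvd_card' p h
      have hxZ : (x : G) ∈ Q := (hs ⟨x.2, by rwa [Subgroup.orderOf_coe]⟩).2
      apply hQp
      rw [← hx, ← Subgroup.orderOf_coe, ← Subgroup.orderOf_mk _ hxZ]
      exact orderOf_dvd_natCard _
    have hsup : ¬ p ∣ Nat.card (Q ⊔ L : Subgroup G) := by
      rw [← Subgroup.relIndex_bot_left (Q ⊔ L),
        ← Subgroup.relIndex_mul_relIndex ⊥ Q (Q ⊔ L) bot_le le_sup_left, Subgroup.relIndex_sup_left,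
        Subgroup.relIndex_bot_left]
      exact hp.not_dvd_mul hQp fun h => hpL (h.trans (Subgroup.relIndex_dvd_card _ _))
    have := hQ.le_of_ge ⟨inferInstance, hsup⟩ le_sup_left
    exact hZL.not_ge (le_inf hLC (le_sup_right.trans this))

/-! ### Normal `p`-subgroups in characteristic `p` -/

/-- The additive span of one orbit is a finite elementary abelian `p`-group, whatever the size of
`k`. Counting fixed points modulo `p` there gives one besides `0`. -/
theorem exists_fixed_ne_zero_of_isPGroup {k G V : Type*} [Field k] {p : ℕ} (hp : p.Prime)
    [CharP k p] [Group G] [Finite G] (hG : IsPGroup p G) [AddCommGroup V] [Module k V]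
    (ρ : Representation k G V) (U : Submodule k V) (hU : ∀ g, ∀ v ∈ U, ρ g v ∈ U) (hne : U ≠ ⊥) :
    ∃ v ∈ U, v ≠ 0 ∧ ∀ g, ρ g v = v := by
  have : Fact p.Prime := ⟨hp⟩
  obtain ⟨u, huU, hu⟩ := Submodule.exists_mem_ne_zero_of_ne_bot hne
  have hpV : ∀ v : V, p • v = 0 := fun v => by
    rw [← Nat.cast_smul_eq_nsmul k, CharP.cast_eq_zero, zero_smul]
  let W : AddSubgroup V := AddSubgroup.closure (Set.range fun g => ρ g u)
  have hWU : ∀ w ∈ W, w ∈ U := by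
    intro w hw
    have : W ≤ U.toAddSubgroup := by
      rw [AddSubgroup.closure_le]
      rintro _ ⟨g, rfl⟩
      exact hU g u huU
    exact this hw
  have hWG : ∀ g, ∀ w ∈ W, ρ g w ∈ W := by
    intro g w hw
    have : W ≤ W.comap (ρ g).toAddMonoidHom := by
      rw [AddSubgroup.closure_le]
      rintro _ ⟨h, rfl⟩
      refine AddSubgroup.subset_closure ⟨g * h, ?_⟩
      simp
    exact this hw
  have huW : u ∈ W := AddSubgroup.subset_closure ⟨1, by simp⟩
  have : AddGroup.FG W := by
    rw [AddGroup.fg_iff_addSubgroup_fg, AddSubgroup.fg_iff]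
    exact ⟨_, rfl, Set.finite_range _⟩
  have : Module.Finite ℤ W := Module.Finite.iff_addGroup_fg.mpr this
  have : Finite W := AddCommGroup.finite_of_fg_isAddTorsion W fun w =>
    isOfFinAddOrder_iff_nsmul_eq_zero.mpr ⟨p, hp.pos, Subtype.ext (hpV w)⟩
  let _ : MulAction G W :=
    { smul := fun g w => ⟨ρ g w, hWG g w w.2⟩
      one_smul := fun w => Subtype.ext (by change ρ 1 (w : V) = w; simp)
      mul_smul := fun g h w => Subtype.ext (by change ρ (g * h) (w : V) = ρ g (ρ h w); simp) }
  have hcard : p ∣ Nat.card W := by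
    have : addOrderOf (⟨u, huW⟩ : W) = p :=
      addOrderOf_eq_prime (Subtype.ext (hpV u)) fun h => hu (congrArg Subtype.val h)
    rw [← this]
    exact addOrderOf_dvd_natCard _
  have h0 : (0 : W) ∈ MulAction.fixedPoints G W := fun g => Subtype.ext (map_zero (ρ g))
  obtain ⟨w, hw, hw0⟩ := hG.exists_fixed_point_of_prime_dvd_card_of_fixed_point W hcard h0
  refine ⟨w, hWU w w.2, fun h => hw0 (Subtype.ext h.symm), fun g => ?_⟩
  exact congrArg Subtype.val (hw g)

/-- The `P`-fixed vectors form a subrepresentation because `P` is normal. An invariant complement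
has no nonzero `P`-fixed vector, so it is zero. -/
theorem Representation.eq_bot_of_isPGroup_of_normal {k G V : Type*} [Field k] {p : ℕ}
    (hp : p.Prime) [CharP k p] [Group G] [Finite G] [AddCommGroup V] [Module k V]
    (ρ : Representation k G V) [h : ρ.IsSemisimpleRepresentation]
    (hρ : Function.Injective ρ) (P : Subgroup G) (hPn : P.Normal) (hP : IsPGroup p P) : P = ⊥ := by
  let F : Subrepresentation ρ :=
    { toSubmodule :=
        { carrier := {v | ∀ g ∈ P, ρ g v = v}
          add_mem' := fun {a b} ha hb g hg => by rw [map_add, ha g hg, hb g hg]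
          zero_mem' := fun g _ => map_zero _
          smul_mem' := fun c v hv g hg => by rw [map_smul, hv g hg] }
      apply_mem_toSubmodule := fun g v hv x hx => by
        have h1 := hv (g⁻¹ * x * g) (by simpa using hPn.conj_mem x hx g⁻¹)
        have h2 : ρ (g * (g⁻¹ * x * g)) v = ρ g v := by
          rw [map_mul, Module.End.mul_apply, h1]
        have h3 : x * g = g * (g⁻¹ * x * g) := by group
        change ρ x (ρ g v) = ρ g v
        rw [← Module.End.mul_apply, ← map_mul, h3, h2] }
  obtain ⟨U, hU⟩ := exists_isCompl F
  have hUbot : U.toSubmodule = ⊥ := by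
    by_contra hne
    obtain ⟨v, hvU, hv0, hv⟩ := exists_fixed_ne_zero_of_isPGroup hp hP (ρ.comp P.subtype)
      U.toSubmodule (fun g v hv => U.apply_mem_toSubmodule g hv) hne
    have hvF : v ∈ F.toSubmodule := fun g hg => hv ⟨g, hg⟩
    have h1 : v ∈ F ⊓ U := ⟨hvF, hvU⟩
    rw [hU.inf_eq_bot] at h1
    exact hv0 h1
  have hFtop : ∀ v, v ∈ F.toSubmodule := by
    intro v
    have h1 : v ∈ (F ⊔ U).toSubmodule := by
      rw [hU.sup_eq_top]
      exact Submodule.mem_top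
    have h2 : (F ⊔ U).toSubmodule = F.toSubmodule ⊔ U.toSubmodule := rfl
    rwa [h2, hUbot, sup_bot_eq] at h1
  rw [eq_bot_iff]
  intro g hg
  exact hρ ((LinearMap.ext fun v => by rw [map_one]; exact hFtop v g hg))

/-! ### Coprime action on Sylow subgroups -/

/-- For each `q` the number of Sylow `q`-subgroups of `Q` is prime to `p`, so `x` normalizes one.
Were all of these centralized, the centralizer of `x` in `Q` would have order divisible by `|Q|`. -/
theorem exists_isPGroup_conj_ne {G : Type*} [Group G] [Finite G] {p : ℕ} (hp : p.Prime) {x : G}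
    (hx : orderOf x = p) {Q : Subgroup G} (hQ : Q.Normal) (hQp : ¬ p ∣ Nat.card Q)
    (hxQ : x ∉ Subgroup.centralizer (Q : Set G)) :
    ∃ q : ℕ, q.Prime ∧ ∃ S : Subgroup G, S ≤ Q ∧ IsPGroup q S ∧ (∀ s ∈ S, x * s * x⁻¹ ∈ S) ∧
      ∃ y ∈ S, x * y * x⁻¹ ≠ y := by
  have : Fact p.Prime := ⟨hp⟩
  by_contra! hcon
  have hA : IsPGroup p (Subgroup.zpowers x) :=
    IsPGroup.of_card (n := 1) (by rw [Nat.card_zpowers, hx, pow_one])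
  let _ : MulDistribMulAction (Subgroup.zpowers x) Q :=
    MulDistribMulAction.compHom Q
      ((MulAut.conjNormal (H := Q)).comp (Subgroup.zpowers x).subtype)
  have hsmul : ∀ s : Q, (((⟨x, Subgroup.mem_zpowers x⟩ : Subgroup.zpowers x) • s : Q) : G)
      = x * s * x⁻¹ := fun s => rfl
  let C : Subgroup G := Subgroup.centralizer {x} ⊓ Q
  have hdvd : Nat.card Q ∣ Nat.card C := by
    rw [Nat.dvd_iff_prime_pow_dvd_dvd]
    intro q e hq hqe
    have : Fact q.Prime := ⟨hq⟩
    have hns : ¬ p ∣ Nat.card (Sylow q Q) := fun h =>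
      hQp (h.trans (((default : Sylow q Q).card_dvd_index).trans (Subgroup.index_dvd_card _)))
    obtain ⟨S, hS⟩ := hA.nonempty_fixed_point_of_prime_not_dvd_card (Sylow q Q) hns
    have hfix : ∀ s ∈ S, (⟨x, Subgroup.mem_zpowers x⟩ : Subgroup.zpowers x) • s ∈ S := by
      intro s hs
      have := hS ⟨x, Subgroup.mem_zpowers x⟩
      have hmem := Subgroup.smul_mem_pointwise_smul s
        (⟨x, Subgroup.mem_zpowers x⟩ : Subgroup.zpowers x) (S : Subgroup Q) hs
      rwa [← Sylow.pointwise_smul_def, this] at hmem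
    have hSC : (S : Subgroup Q).map Q.subtype ≤ C := by
      refine le_inf ?_ (Subgroup.map_subtype_le _)
      intro s hs
      have := hcon q hq _ (Subgroup.map_subtype_le _) (S.isPGroup'.map Q.subtype) ?_ s hs
      · rw [Subgroup.mem_centralizer_singleton_iff]
        exact (mul_inv_eq_iff_eq_mul.mp this).symm
      · rintro _ ⟨s, hs, rfl⟩
        exact ⟨_, hfix s hs, hsmul s⟩
    refine (S.pow_dvd_card_of_pow_dvd_card hqe).trans ?_
    refine (Nat.card_congr
      ((S : Subgroup Q).equivMapOfInjective _ Q.subtype_injective).toEquiv).dvd.trans ?_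
    exact Subgroup.card_dvd_of_le hSC
  have hCQ : C = Q := Subgroup.eq_of_le_of_card_ge inf_le_right (Nat.le_of_dvd Nat.card_pos hdvd)
  apply hxQ
  rw [Subgroup.mem_centralizer_iff]
  intro y hy
  have : y ∈ C := by rw [hCQ]; exact hy
  exact Subgroup.mem_centralizer_singleton_iff.mp this.1

/-! ### The trace argument -/

theorem sum_mul_eq_zero_of_sum_pow_apply_eq_zero {K S : Type*} [Field K] [Finite S] {p : ℕ}
    (hp : p.Prime) {σ : Equiv.Perm S} (hσ : σ ^ p = 1) {l c : S → K} (hl : ∀ s, l (σ s) = l s)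
    (hfix : ∀ s, σ s = s → l s = 0) (hc : ∀ s, ∑ i ∈ Finset.range p, c ((σ ^ i) s) = 0) :
    ∑ᶠ s, l s * c s = 0 := by
  classical
  have := Fintype.ofFinite S
  rw [finsum_eq_sum_of_fintype]
  have hlpow : ∀ (i : ℕ) s, l ((σ ^ i) s) = l s := by
    intro i s
    induction i with
    | zero => rfl
    | succ i ih => rw [pow_succ', Equiv.Perm.mul_apply, hl, ih]
  -- Split by cycles of `σ`: these are fixed points, where `l` vanishes, or have length exactly `p`,
  -- where `l` is constant and `c` sums to zero.
  rw [← Finset.sum_fiberwise Finset.univ (Quotient.mk (Equiv.Perm.SameCycle.setoid σ))]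
  refine Finset.sum_eq_zero fun w _ => ?_
  obtain ⟨s, rfl⟩ := Quotient.exists_rep w
  by_cases hs : σ s = s
  · refine Finset.sum_eq_zero fun t ht => ?_
    have hst : σ.SameCycle t s := Quotient.exact (Finset.mem_filter.mp ht).2
    have : σ t = t := hst.apply_eq_self_iff.mpr hs
    rw [hfix t this, zero_mul]
  · have hinj : Set.InjOn (fun i : ℕ => (σ ^ i) s) (Finset.range p) := by
      have hper : Function.IsPeriodicPt σ p s := by
        rw [Function.IsPeriodicPt, ← Equiv.Perm.coe_pow, hσ]
        rfl
      have hmin : Function.minimalPeriod σ s = p := by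
        refine ((Nat.dvd_prime hp).mp hper.minimalPeriod_dvd).resolve_left fun h => hs ?_
        exact Function.minimalPeriod_eq_one_iff_isFixedPt.mp h
      intro i hi j hj hij
      simp only [Equiv.Perm.coe_pow] at hij
      exact Function.iterate_injOn_Iio_minimalPeriod (by simpa [hmin] using hi)
        (by simpa [hmin] using hj) hij
    have himg : Finset.univ.filter (fun t => Quotient.mk (Equiv.Perm.SameCycle.setoid σ) t =
        Quotient.mk (Equiv.Perm.SameCycle.setoid σ) s) =
        (Finset.range p).image fun i => (σ ^ i) s := by
      ext t
      simp only [Finset.mem_filter, Finset.mem_univ, true_and, Finset.mem_image, Finset.mem_range]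
      constructor
      · intro h
        have hst : σ.SameCycle t s := Quotient.exact h
        obtain ⟨i, _, hi⟩ := hst.symm.exists_pow_eq'
        exact ⟨i % p, Nat.mod_lt _ hp.pos, by rw [← pow_eq_pow_mod i hσ, hi]⟩
      · rintro ⟨i, _, rfl⟩
        exact Quotient.sound (Equiv.Perm.SameCycle.symm ⟨i, by simp⟩)
    rw [himg, Finset.sum_image hinj]
    simp_rw [hlpow]
    rw [← Finset.mul_sum, hc, mul_zero]

open Polynomial in
theorem geom_sum_X_eq_sub_pow {K : Type*} [Field K] (p : ℕ) (hp : p.Prime) [CharP K p] :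
    ∑ i ∈ Finset.range p, (X : K[X]) ^ i = (X - 1) ^ (p - 1) := by
  have : Fact p.Prime := ⟨hp⟩
  have h : (X - 1 : K[X]) ≠ 0 := by
    rw [← C_1]
    exact X_sub_C_ne_zero 1
  refine mul_right_cancel₀ h ?_
  rw [geom_sum_mul, ← pow_succ, Nat.sub_add_cancel hp.one_le, sub_pow_char, one_pow]

/-- With `N = u - 1`, take `c = Y N ^ (r - 2)`. Then `c N ^ 2 = 0` makes `c v ^ i` affine in `i`, so
the sum involves only `∑ u ^ i = N ^ (p - 1)` and `∑ i u ^ i`, a multiple of `N ^ (p - 2)`. Both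
vanish as `r ≤ p - 2`, while `tr(N c) = tr(N ^ (r - 1) Y)` is nonzero for some `Y`. -/
theorem exists_sum_conj_eq_zero_trace_ne_zero {K ι : Type*} [Field K] [Fintype ι] [DecidableEq ι]
    {p : ℕ} (hp : p.Prime) [CharP K p] {u v : Matrix ι ι K} (huv : u * v = 1) {r : ℕ}
    (hr : 2 ≤ r) (hrp : r + 2 ≤ p) (h0 : (u - 1) ^ r = 0) (h1 : (u - 1) ^ (r - 1) ≠ 0) :
    ∃ c : Matrix ι ι K, ∑ i ∈ Finset.range p, u ^ i * c * v ^ i = 0 ∧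
      Matrix.trace ((u - 1) * c) ≠ 0 := by
  have hvu : v * u = 1 := mul_eq_one_comm.mp huv
  set N := u - 1 with hN
  obtain ⟨Y, hY⟩ : ∃ Y : Matrix ι ι K, Matrix.trace (N ^ (r - 1) * Y) ≠ 0 := by
    by_contra! h
    exact h1 (Matrix.ext_iff_trace_mul_right.mpr fun Y => by simpa using h Y)
  refine ⟨Y * N ^ (r - 2), ?_, ?_⟩
  · set c := Y * N ^ (r - 2) with hc
    have hcN : c * (N * N) = 0 := by
      rw [hc, mul_assoc, ← pow_two, ← pow_add, Nat.sub_add_cancel hr, h0, mul_zero]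
    have hvN : Commute v N := by
      rw [hN]
      exact Commute.sub_right (by rw [Commute, SemiconjBy, hvu, huv]) (Commute.one_right v)
    have hv : v - 1 = - (v * N) := by rw [hN, mul_sub, hvu, mul_one, neg_sub]
    have hcv : ∀ i : ℕ, c * v ^ i = c + (i : K) • (c * (v - 1)) := by
      intro i
      induction i with
      | zero => simp
      | succ i ih =>
        have h2 : c * (v - 1) * (v - 1) = 0 := by
          rw [hv]
          calc c * -(v * N) * -(v * N) = c * (v * N * (v * N)) := by noncomm_ring
            _ = c * (N * N) * (v * v) := by
              rw [hvN.eq, mul_assoc N v, ← mul_assoc v N v, hvN.eq]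
              simp only [mul_assoc]
            _ = 0 := by rw [hcN, zero_mul]
        have h3 : c * (v - 1) * v = c * (v - 1) := by
          rwa [mul_sub _ v 1, mul_one, sub_eq_zero] at h2
        rw [pow_succ, ← mul_assoc, ih, add_mul, smul_mul_assoc, h3]
        push_cast
        rw [add_smul, one_smul, mul_sub, mul_one]
        abel
    have hgeom := geom_sum_X_eq_sub_pow (K := K) p hp
    have hs1 : ∑ i ∈ Finset.range p, u ^ i = 0 := by
      have := congrArg (Polynomial.aeval u) hgeom
      simp only [map_sum, map_pow, Polynomial.aeval_X, map_sub, map_one] at this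
      rw [this, ← hN]
      exact pow_eq_zero_of_le (by omega) h0
    -- Apply `X d/dX` to the geometric sum identity and evaluate at `u`.
    have hs2 : ∑ i ∈ Finset.range p, (i : K) • u ^ i = 0 := by
      have := congrArg (fun f => Polynomial.aeval u (Polynomial.X * Polynomial.derivative f)) hgeom
      simp only [Polynomial.derivative_pow, Polynomial.derivative_X, Finset.mul_sum, map_sum,
        map_mul, map_pow, Polynomial.aeval_X,
        map_sub, map_one, ← hN, Polynomial.aeval_C] at this
      rw [pow_eq_zero_of_le (by omega : r ≤ p - 1 - 1) h0] at this
      simp only [mul_zero, zero_mul] at this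
      rw [← this]
      refine Finset.sum_congr rfl fun i _ => ?_
      rcases i with _ | i
      · simp
      · rw [Algebra.algebraMap_eq_smul_one, smul_mul_assoc, one_mul, mul_one,
          mul_smul_comm, Nat.add_sub_cancel, pow_succ']
    have : ∀ i ∈ Finset.range p, u ^ i * c * v ^ i =
        u ^ i * c + ((i : K) • u ^ i) * (c * (v - 1)) := by
      intro i _
      rw [mul_assoc, hcv, mul_add, mul_smul_comm, smul_mul_assoc]
    rw [Finset.sum_congr rfl this, Finset.sum_add_distrib, ← Finset.sum_mul, ← Finset.sum_mul,
      hs1, hs2, zero_mul, zero_mul, add_zero]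
  · rw [← mul_assoc, Matrix.trace_mul_comm, ← mul_assoc, ← pow_succ]
    rwa [show r - 2 + 1 = r - 1 by omega]

/-! ### Irreducible degrees of `q`-groups divide the order, in any characteristic -/

/-- Lift a nontrivial central element of the `q`-group `G / Z`, where `Z` consists of the elements
acting as scalars. -/
theorem exists_commutator_scalar {K V G : Type*} [Field K] [AddCommGroup V] [Module K V]
    [Group G] [Finite G] {q : ℕ} (hq : q.Prime) (hG : IsPGroup q G)
    (ρ : G →* Module.End K V) (h : ∃ g, ∀ c : K, ρ g ≠ c • 1) :
    ∃ a : G, (∀ c : K, ρ a ≠ c • 1) ∧ ∀ g, ∃ c : K, ρ (a * g * a⁻¹ * g⁻¹) = c • 1 := by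
  have : Fact q.Prime := ⟨hq⟩
  let Z : Subgroup G :=
    { carrier := {g | ∃ c : K, ρ g = c • 1}
      one_mem' := ⟨1, by simp⟩
      mul_mem' := by
        rintro a b ⟨c, hc⟩ ⟨d, hd⟩
        exact ⟨c * d, by rw [map_mul, hc, hd, smul_mul_smul_comm, one_mul]⟩
      inv_mem' := by
        rintro a ⟨c, hc⟩
        refine ⟨c⁻¹, ?_⟩
        have h1 : ρ a⁻¹ * ρ a = 1 := by rw [← map_mul, inv_mul_cancel, map_one]
        rw [hc, mul_smul_comm, mul_one] at h1
        rcases eq_or_ne c 0 with rfl | hc0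
        · rw [zero_smul] at h1
          rw [inv_zero, zero_smul, ← mul_one (ρ a⁻¹), ← h1, mul_zero]
        · rw [← h1, smul_smul, inv_mul_cancel₀ hc0, one_smul] }
  have hZn : Z.Normal := ⟨by
    rintro a ⟨c, hc⟩ g
    refine ⟨c, ?_⟩
    rw [map_mul, map_mul, hc, mul_smul_comm, smul_mul_assoc, mul_one, ← map_mul,
      mul_inv_cancel, map_one]⟩
  have hZtop : Z ≠ ⊤ := by
    rintro hZ
    obtain ⟨g, hg⟩ := h
    obtain ⟨c, hc⟩ : g ∈ Z := hZ ▸ Subgroup.mem_top g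
    exact hg c hc
  have : Nontrivial (G ⧸ Z) := by
    rwa [QuotientGroup.nontrivial_iff]
  have hQ : IsPGroup q (G ⧸ Z) := hG.to_quotient Z
  have := hQ.center_nontrivial
  obtain ⟨⟨z, hz⟩, hz1⟩ := exists_ne (1 : Subgroup.center (G ⧸ Z))
  obtain ⟨a, rfl⟩ := QuotientGroup.mk_surjective z
  refine ⟨a, fun c hc => hz1 ?_, fun g => ?_⟩
  · exact Subtype.ext ((QuotientGroup.eq_one_iff a).mpr ⟨c, hc⟩)
  · have h1 := Subgroup.mem_center_iff.mp hz (g : G ⧸ Z)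
    have : a * g * a⁻¹ * g⁻¹ ∈ Z := by
      rw [← QuotientGroup.eq_one_iff]
      have h2 : ((a * g * a⁻¹ * g⁻¹ : G) : G ⧸ Z) =
          (a : G ⧸ Z) * g * (a : G ⧸ Z)⁻¹ * (g : G ⧸ Z)⁻¹ := rfl
      rw [h2, ← h1]
      group
    exact this

theorem Module.End.forall_mem_of_span_eq_top {K V G : Type*} [Field K] [AddCommGroup V]
    [Module K V] {ρ : G → Module.End K V} (hρ : Submodule.span K (Set.range ρ) = ⊤)
    {U : Submodule K V} (hU : ∀ g, ∀ v ∈ U, ρ g v ∈ U) (f : Module.End K V) :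
    ∀ v ∈ U, f v ∈ U := by
  have hf : f ∈ Submodule.span K (Set.range ρ) := hρ ▸ Submodule.mem_top
  induction hf using Submodule.span_induction with
  | mem x hx => obtain ⟨g, rfl⟩ := hx; exact hU g
  | zero => intro v _; exact U.zero_mem
  | add x y _ _ hx hy => intro v hv; exact U.add_mem (hx v hv) (hy v hv)
  | smul c x _ hx => intro v hv; exact U.smul_mem c (hx v hv)

theorem Module.End.eq_top_of_span_eq_top {K V G : Type*} [Field K] [AddCommGroup V]
    [Module K V] {ρ : G → Module.End K V} (hρ : Submodule.span K (Set.range ρ) = ⊤)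
    {U : Submodule K V} (hU : ∀ g, ∀ v ∈ U, ρ g v ∈ U) (hne : U ≠ ⊥) : U = ⊤ := by
  obtain ⟨u, hu, hu0⟩ := Submodule.exists_mem_ne_zero_of_ne_bot hne
  obtain ⟨φ, hφ⟩ := Module.Projective.exists_dual_eq_one K hu0
  rw [eq_top_iff]
  intro v _
  have := Module.End.forall_mem_of_span_eq_top hρ hU (LinearMap.smulRight φ v) u hu
  simpa [hφ] using this

theorem finrank_le_of_injective_of_mapsTo {K V : Type*} [Field K] [AddCommGroup V] [Module K V]
    [FiniteDimensional K V] {f : Module.End K V} (hf : Function.Injective f) {U W : Submodule K V}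
    (h : ∀ v ∈ U, f v ∈ W) : Module.finrank K U ≤ Module.finrank K W := by
  rw [(Submodule.equivMapOfInjective f hf U).finrank_eq]
  refine Submodule.finrank_mono ?_
  rintro _ ⟨v, hv, rfl⟩
  exact h v hv

theorem exists_character_of_commutator_scalar {K V G : Type*} [Field K] [AddCommGroup V]
    [Module K V] [Nontrivial V] [Group G] (ρ : G →* Module.End K V) (a : G)
    (h : ∀ g, ∃ c : K, ρ (a * g * a⁻¹ * g⁻¹) = c • 1) :
    ∃ χ : G →* Kˣ, ∀ g, ρ a * ρ g = (χ g : K) • (ρ g * ρ a) := by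
  choose χ₀ hχ₀ using h
  have hχ : ∀ g, ρ a * ρ g = χ₀ g • (ρ g * ρ a) := by
    intro g
    have h1 : a * g = (a * g * a⁻¹ * g⁻¹) * (g * a) := by group
    rw [← map_mul, h1, map_mul, hχ₀, smul_mul_assoc, one_mul, map_mul]
  have hρne : ∀ g, ρ g ≠ 0 := fun g h => by
    have h1 : ρ g * ρ g⁻¹ = 1 := by rw [← map_mul, mul_inv_cancel, map_one]
    rw [h, zero_mul] at h1
    exact zero_ne_one h1
  have huniq : ∀ g (c d : K), c • ρ g = d • ρ g → c = d := fun g c d h =>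
    smul_left_injective K (hρne g) h
  let χm : G →* K :=
    { toFun := χ₀
      map_one' := by
        refine huniq a _ _ ?_
        have := hχ 1
        simpa using this.symm
      map_mul' := fun g h => by
        refine huniq (g * h * a) _ _ ?_
        rw [map_mul, map_mul, mul_assoc, ← mul_assoc (ρ g), ← map_mul, ← hχ, map_mul,
          ← mul_assoc, hχ, smul_mul_assoc, mul_assoc, hχ, mul_smul_comm, smul_smul, ← mul_assoc] }
  exact ⟨χm.toHomUnits, hχ⟩

section EigenspaceDecomposition

variable {K V G : Type*} [Field K] [AddCommGroup V] [Module K V] [Group G]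
  {ρ : G →* Module.End K V} {A : Module.End K V} {χ : G →* Kˣ}

theorem apply_mem_eigenspace (hA : ∀ g, A * ρ g = (χ g : K) • (ρ g * A)) (g : G) (μ : K) {v : V}
    (hv : v ∈ A.eigenspace μ) : ρ g v ∈ A.eigenspace (χ g * μ) := by
  rw [Module.End.mem_eigenspace_iff] at hv ⊢
  rw [← Module.End.mul_apply, hA, LinearMap.smul_apply, Module.End.mul_apply, hv, map_smul,
    smul_smul]

theorem apply_mem_eigenspace_of_mem_ker (hA : ∀ g, A * ρ g = (χ g : K) • (ρ g * A)) {g : G}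
    (hg : g ∈ χ.ker) (μ : K) {v : V} (hv : v ∈ A.eigenspace μ) : ρ g v ∈ A.eigenspace μ := by
  have h1 := apply_mem_eigenspace hA g μ hv
  rwa [MonoidHom.mem_ker.mp hg, Units.val_one, one_mul] at h1

theorem finrank_eigenspace_mul [FiniteDimensional K V]
    (hA : ∀ g, A * ρ g = (χ g : K) • (ρ g * A)) (g : G) (μ : K) :
    Module.finrank K (A.eigenspace (χ g * μ)) = Module.finrank K (A.eigenspace μ) := by
  have hinj : ∀ g, Function.Injective (ρ g) := fun g => by
    refine Function.LeftInverse.injective (g := ρ g⁻¹) fun v => ?_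
    rw [← Module.End.mul_apply, ← map_mul, inv_mul_cancel, map_one, Module.End.one_apply]
  have hle : ∀ g μ, Module.finrank K (A.eigenspace μ) ≤
      Module.finrank K (A.eigenspace (χ g * μ)) := fun g μ =>
    finrank_le_of_injective_of_mapsTo (hinj g) fun v hv => apply_mem_eigenspace hA g μ hv
  refine le_antisymm ?_ (hle g μ)
  have := hle g⁻¹ (χ g * μ)
  rwa [← mul_assoc, ← Units.val_mul, ← map_mul, inv_mul_cancel, map_one, Units.val_one,
    one_mul] at this

/-- The eigenspaces for `χ(g) μ` are permuted transitively by `G`; their sum is invariant, hence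
everything, and there are `|χ.range|` of them. -/
theorem finrank_eq_index_mul_finrank_eigenspace [FiniteDimensional K V] [Finite G]
    (hA : ∀ g, A * ρ g = (χ g : K) • (ρ g * A)) (hρ : Submodule.span K (Set.range ρ) = ⊤)
    {μ : K} (hμ : A.eigenspace μ ≠ ⊥) (hμ0 : μ ≠ 0) :
    Module.finrank K V = χ.ker.index * Module.finrank K (A.eigenspace μ) := by
  classical
  let F : χ.range → Submodule K V := fun z => A.eigenspace (((z : Kˣ) : K) * μ)
  have hFinj : Function.Injective fun z : χ.range => (((z : Kˣ) : K) * μ) := by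
    intro z w h
    exact Subtype.ext (Units.ext (mul_right_cancel₀ hμ0 h))
  have hFind : iSupIndep F := (Module.End.eigenspaces_iSupIndep A).comp hFinj
  have hFtop : iSup F = ⊤ := by
    refine Module.End.eq_top_of_span_eq_top hρ (fun g => ?_) ?_
    · have : iSup F ≤ (iSup F).comap (ρ g) := by
        refine iSup_le fun z v hv => ?_
        have h1 : ρ g v ∈ A.eigenspace (χ g * (((z : Kˣ) : K) * μ)) :=
          apply_mem_eigenspace hA g _ hv
        have h2 : F (χ.rangeRestrict g * z) = A.eigenspace (χ g * (((z : Kˣ) : K) * μ)) := by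
          rw [← mul_assoc, ← Units.val_mul]
          rfl
        rw [← h2] at h1
        exact le_iSup F _ h1
      exact this
    · intro h
      have h1 : F 1 ≤ ⊥ := h ▸ le_iSup F 1
      apply hμ
      rw [eq_bot_iff]
      have h2 : F 1 = A.eigenspace μ := by
        change A.eigenspace (((1 : Kˣ) : K) * μ) = _
        rw [Units.val_one, one_mul]
      rwa [← h2]
  have hFdim : ∀ z, Module.finrank K (F z) = Module.finrank K (A.eigenspace μ) := by
    rintro ⟨_, g, rfl⟩
    exact finrank_eigenspace_mul hA g μ
  have : Finite χ.range := Finite.of_surjective _ χ.rangeRestrict_surjective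
  have : Fintype χ.range := Fintype.ofFinite _
  have hint : DirectSum.IsInternal F :=
    DirectSum.isInternal_submodule_of_iSupIndep_of_iSup_eq_top hFind hFtop
  rw [← (LinearEquiv.ofBijective (DirectSum.coeLinearMap F) hint).finrank_eq,
    Module.finrank_directSum, Finset.sum_congr rfl fun z _ => hFdim z, Finset.sum_const,
    Finset.card_univ, ← Nat.card_eq_fintype_card, ← Subgroup.index_ker, smul_eq_mul]

/-- The action of `ker χ` on an eigenspace of `A`. -/
def eigenspaceHom (hA : ∀ g, A * ρ g = (χ g : K) • (ρ g * A)) (μ : K) :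
    χ.ker →* Module.End K (A.eigenspace μ) where
  toFun g := (ρ g).restrict fun _ hv => apply_mem_eigenspace_of_mem_ker hA g.2 μ hv
  map_one' := by ext v; simp
  map_mul' g h := by ext v; simp

theorem span_range_eigenspaceHom (hA : ∀ g, A * ρ g = (χ g : K) • (ρ g * A))
    (hρ : Submodule.span K (Set.range ρ) = ⊤) {μ : K} (hμ0 : μ ≠ 0) :
    Submodule.span K (Set.range (eigenspaceHom hA μ)) = ⊤ := by
  -- A complement containing all other eigenspaces: compressing `ρ g` to the `μ`-eigenspace gives
  -- zero when `g` is outside `χ.ker`, so `χ.ker` already spans.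
  obtain ⟨U, hU, hcompl⟩ := (Module.End.eigenspaces_iSupIndep A μ).symm.exists_isCompl
  let P := Submodule.projectionOnto (A.eigenspace μ) U hcompl.symm
  let Ψ : Module.End K V →ₗ[K] Module.End K (A.eigenspace μ) :=
    { toFun := fun f => P ∘ₗ f ∘ₗ (A.eigenspace μ).subtype
      map_add' := fun f g => by ext v; simp
      map_smul' := fun c f => by ext v; simp }
  have hP : ∀ w : A.eigenspace μ, P w = w := Submodule.projectionOnto_apply_left hcompl.symm
  have hΨ : ∀ f, Ψ f ∈ Submodule.span K (Set.range (eigenspaceHom hA μ)) := by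
    intro f
    have hf : f ∈ Submodule.span K (Set.range ρ) := hρ ▸ Submodule.mem_top
    induction hf using Submodule.span_induction with
    | zero => rw [map_zero]; exact Submodule.zero_mem _
    | add x y _ _ hx hy => rw [map_add]; exact Submodule.add_mem _ hx hy
    | smul c x _ hx => rw [map_smul]; exact Submodule.smul_mem _ _ hx
    | mem x hx =>
      obtain ⟨g, rfl⟩ := hx
      by_cases hg : g ∈ χ.ker
      · refine Submodule.subset_span ⟨⟨g, hg⟩, ?_⟩
        refine LinearMap.ext fun w => ?_
        exact (hP ⟨ρ g w, apply_mem_eigenspace_of_mem_ker hA hg μ w.2⟩).symm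
      · have : Ψ (ρ g) = 0 := by
          refine LinearMap.ext fun w => ?_
          refine Submodule.projectionOnto_apply_of_mem_right hcompl.symm (hU ?_)
          have hne : (χ g : K) * μ ≠ μ := fun h => by
            refine hg (MonoidHom.mem_ker.mpr (Units.ext ?_))
            exact mul_right_cancel₀ hμ0 (h.trans (one_mul μ).symm)
          exact (le_iSup₂_of_le (f := fun ν (_ : ν ≠ μ) => A.eigenspace ν) _ hne le_rfl)
            (apply_mem_eigenspace hA g μ w.2)
        rw [this]
        exact Submodule.zero_mem _
  rw [eq_top_iff]
  intro e _
  have : Ψ ((A.eigenspace μ).subtype ∘ₗ e ∘ₗ P) = e := by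
    refine LinearMap.ext fun w => ?_
    change P (e (P w) : V) = e w
    rw [hP, hP]
  rw [← this]
  exact hΨ _

end EigenspaceDecomposition

/-- If not all of `G` is scalar, an eigenspace of a nonscalar `ρ a` with scalar commutators carries
a spanning representation of the proper subgroup `χ.ker`; induct and multiply by its index. -/
theorem finrank_dvd_card_of_span_eq_top {K : Type*} [Field K] [IsAlgClosed K] {q : ℕ}
    (hq : q.Prime) (G : Type*) [Group G] [Finite G]
    (hG : IsPGroup q G) (V : Type*) [AddCommGroup V] [Module K V] [FiniteDimensional K V]
    [Nontrivial V] (ρ : G →* Module.End K V)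
    (hρ : Submodule.span K (Set.range ρ) = ⊤) : Module.finrank K V ∣ Nat.card G := by
  induction hN : Nat.card G using Nat.strong_induction_on generalizing G V with
  | _ N ih =>
  rw [← hN]
  by_cases hscal : ∀ g, ∃ c : K, ρ g = c • 1
  · have h1 : (⊤ : Submodule K (Module.End K V)) ≤ Submodule.span K {1} := by
      rw [← hρ, Submodule.span_le]
      rintro _ ⟨g, rfl⟩
      obtain ⟨c, hc⟩ := hscal g
      rw [hc]
      exact Submodule.smul_mem _ _ (Submodule.mem_span_singleton_self _)
    have h2 : Module.finrank K (Module.End K V) ≤ 1 := by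
      rw [← finrank_top K (Module.End K V)]
      exact (Submodule.finrank_mono h1).trans (finrank_span_singleton (one_ne_zero)).le
    rw [Module.finrank_linearMap] at h2
    have h3 := Module.finrank_pos (R := K) (M := V)
    have : Module.finrank K V = 1 := by nlinarith
    rw [this]
    exact one_dvd _
  · push Not at hscal
    obtain ⟨a, ha, hcomm⟩ := exists_commutator_scalar hq hG ρ hscal
    obtain ⟨χ, hA⟩ := exists_character_of_commutator_scalar ρ a hcomm
    obtain ⟨μ, hμ⟩ := Module.End.exists_eigenvalue (ρ a)
    have hμE : (ρ a).eigenspace μ ≠ ⊥ := hμ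
    have hμ0 : μ ≠ 0 := by
      rintro rfl
      obtain ⟨v, hv, hv0⟩ := Submodule.exists_mem_ne_zero_of_ne_bot hμE
      rw [Module.End.mem_eigenspace_iff, zero_smul] at hv
      apply hv0
      have : ρ a⁻¹ * ρ a = 1 := by rw [← map_mul, inv_mul_cancel, map_one]
      rw [← Module.End.one_apply (R := K) v, ← this, Module.End.mul_apply, hv, map_zero]
    have hlt : Nat.card χ.ker < N := by
      rw [← hN]
      refine lt_of_le_of_ne (Subgroup.card_le_card_group _) fun h => ?_
      have htop := Subgroup.eq_top_of_card_eq _ h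
      have hE : (ρ a).eigenspace μ = ⊤ :=
        Module.End.eq_top_of_span_eq_top hρ (fun g v hv => apply_mem_eigenspace_of_mem_ker hA
          (htop ▸ Subgroup.mem_top g) μ hv) hμE
      refine ha μ (LinearMap.ext fun v => ?_)
      have hv : v ∈ (ρ a).eigenspace μ := hE ▸ Submodule.mem_top
      rw [Module.End.mem_eigenspace_iff] at hv
      simpa using hv
    have : Nontrivial ((ρ a).eigenspace μ) := Submodule.nontrivial_iff_ne_bot.mpr hμE
    rw [finrank_eq_index_mul_finrank_eigenspace hA hρ hμE hμ0, ← Subgroup.index_mul_card χ.ker]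
    exact mul_dvd_mul_left _ (ih _ hlt χ.ker (hG.to_subgroup _) _ (eigenspaceHom hA μ)
      (span_range_eigenspaceHom hA hρ hμ0) rfl)

/-! ### Automorphisms of matrix algebras and orbits of idempotents -/

theorem Matrix.exists_algebraMap_eq_of_commute {K ι : Type*} [Field K] [Fintype ι] [DecidableEq ι]
    {A : Matrix ι ι K} (hA : ∀ M, Commute A M) : ∃ c : K, algebraMap K _ c = A := by
  obtain ⟨c, hc⟩ := Matrix.mem_range_scalar_iff_commute_single'.mpr
    fun i j => (hA (Matrix.single i j 1)).symm
  refine ⟨c, ?_⟩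
  rw [← hc, Matrix.algebraMap_eq_diagonal]
  rfl

theorem Matrix.exists_conj_of_algEquiv {K ι : Type*} [Field K] [Fintype ι] [DecidableEq ι]
    (τ : Matrix ι ι K ≃ₐ[K] Matrix ι ι K) :
    ∃ u v : Matrix ι ι K, u * v = 1 ∧ ∀ M, τ M = u * M * v := by
  let L : Matrix ι ι K ≃ₐ[K] ((ι → K) →ₗ[K] (ι → K)) := Matrix.toLinAlgEquiv'
  obtain ⟨T, hT⟩ := AlgEquiv.eq_linearEquivConjAlgEquiv (L.symm.trans (τ.trans L))
  refine ⟨L.symm T.toLinearMap, L.symm T.symm.toLinearMap, ?_, fun M => ?_⟩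
  · rw [← map_mul, ← map_one L.symm]
    congr 1
    exact LinearMap.ext fun w => T.apply_symm_apply w
  · have h := congrArg (fun f => L.symm (f (L M))) hT
    simp only [AlgEquiv.trans_apply, AlgEquiv.symm_apply_apply] at h
    rw [h, LinearEquiv.conjAlgEquiv_apply]
    apply L.injective
    rw [map_mul, map_mul]
    simp only [AlgEquiv.apply_symm_apply]
    rfl

theorem Matrix.exists_conj_pow_eq_one {K ι : Type*} [Field K] [IsAlgClosed K] [Fintype ι]
    [DecidableEq ι] [Nonempty ι] {p : ℕ} (hp : p ≠ 0) (τ : Matrix ι ι K ≃ₐ[K] Matrix ι ι K)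
    (hτ : τ ^ p = 1) :
    ∃ u v : Matrix ι ι K, u * v = 1 ∧ u ^ p = 1 ∧ ∀ M, τ M = u * M * v := by
  obtain ⟨u, v, huv, h⟩ := Matrix.exists_conj_of_algEquiv τ
  have hvu : v * u = 1 := mul_eq_one_comm.mp huv
  have hpow : ∀ (i : ℕ) M, (τ ^ i) M = u ^ i * M * v ^ i := by
    intro i
    induction i with
    | zero => intro M; simp
    | succ i ih =>
      intro M
      rw [pow_succ', AlgEquiv.mul_apply, ih, h, pow_succ', pow_succ]
      simp only [mul_assoc]
  have huvp : ∀ i : ℕ, v ^ i * u ^ i = 1 := by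
    intro i
    induction i with
    | zero => simp
    | succ i ih =>
      rw [pow_succ v, pow_succ' u, mul_assoc, ← mul_assoc v u, hvu, one_mul, ih]
  have hcomm : ∀ M, Commute (u ^ p) M := by
    intro M
    have h1 := hpow p M
    rw [hτ, AlgEquiv.one_apply] at h1
    rw [Commute, SemiconjBy]
    nth_rw 2 [h1]
    rw [mul_assoc _ (v ^ p), huvp, mul_one]
  obtain ⟨c, hc⟩ := Matrix.exists_algebraMap_eq_of_commute hcomm
  have hc0 : c ≠ 0 := by
    rintro rfl
    have := huvp p
    rw [← hc, map_zero, mul_zero] at this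
    exact zero_ne_one this
  -- `u ^ p` is a scalar `c`; dividing `u` by a `p`-th root of `c` leaves the conjugation unchanged.
  obtain ⟨b, hb⟩ := IsAlgClosed.exists_pow_nat_eq c (Nat.pos_of_ne_zero hp)
  have hb0 : b ≠ 0 := by
    rintro rfl
    rw [zero_pow hp] at hb
    exact hc0 hb.symm
  refine ⟨b⁻¹ • u, b • v, ?_, ?_, fun M => ?_⟩
  · rw [smul_mul_smul_comm, inv_mul_cancel₀ hb0, one_smul, huv]
  · rw [smul_pow, ← hc, Algebra.algebraMap_eq_smul_one, smul_smul, inv_pow, hb,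
      inv_mul_cancel₀ hc0, one_smul]
  · rw [smul_mul_assoc, smul_mul_smul_comm, inv_mul_cancel₀ hb0, one_smul, h]

open Matrix in
theorem Matrix.le_of_orthogonal_idempotents {K : Type*} [Field K] {n p : ℕ}
    (E : Fin p → Matrix (Fin n) (Fin n) K) (h0 : ∀ i, E i ≠ 0) (hidem : ∀ i, E i * E i = E i)
    (horth : ∀ i j, i ≠ j → E i * E j = 0) : p ≤ n := by
  have hex : ∀ i, ∃ v : Fin n → K, E i *ᵥ v ≠ 0 := by
    intro i
    by_contra! h
    exact h0 i (Matrix.ext_of_mulVec_single fun j => by rw [h, Matrix.zero_mulVec])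
  choose v hv using hex
  have hli : LinearIndependent K fun i => E i *ᵥ v i := by
    rw [Fintype.linearIndependent_iff]
    intro g hg i
    have h1 := congrArg (fun w => E i *ᵥ w) hg
    simp only [Matrix.mulVec_sum, Matrix.mulVec_smul, Matrix.mulVec_mulVec,
      Matrix.mulVec_zero] at h1
    rw [Finset.sum_eq_single i (fun j _ hj => by
      rw [horth i j hj.symm, Matrix.zero_mulVec, smul_zero]) (by simp), hidem] at h1
    exact (smul_eq_zero.mp h1).resolve_right (hv i)
  simpa using hli.fintype_card_le_finrank

/-- If `Θ` moved `e`, its `p` conjugates would be distinct primitive central idempotents, pairwise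
orthogonal. Their images under `ρ` are conjugate by `X`, so all nonzero, forcing `p ≤ n`. -/
theorem Matrix.apply_eq_of_primitive_idempotent {K R : Type*} [Field K] [Ring R] [Algebra K R]
    {p n : ℕ} (hp : p.Prime) (hn : n < p) {Θ : R ≃ₐ[K] R} (hΘ : Θ ^ p = 1) {e : R}
    (he : IsIdempotentElem e) (hec : ∀ r, Commute e r)
    (hprim : ∀ f, IsIdempotentElem f → (∀ r, Commute f r) → e * f = 0 ∨ e * f = e)
    (ρ : R →ₐ[K] Matrix (Fin n) (Fin n) K) {X Y : Matrix (Fin n) (Fin n) K} (hXY : X * Y = 1)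
    (hρ : ∀ r, ρ (Θ r) = X * ρ r * Y) (hρe : ρ e ≠ 0) : Θ e = e := by
  by_contra hne
  have hYX : Y * X = 1 := mul_eq_one_comm.mp hXY
  have he0 : e ≠ 0 := fun h => hρe (by rw [h, map_zero])
  have hidem : ∀ k : ℕ, IsIdempotentElem ((Θ ^ k) e) := fun k => he.map (Θ ^ k)
  have hcent : ∀ (k : ℕ) r, Commute ((Θ ^ k) e) r := by
    intro k r
    have := (hec ((Θ ^ k).symm r)).map (Θ ^ k)
    rwa [AlgEquiv.apply_symm_apply] at this
  have hmin : Function.minimalPeriod Θ e = p := by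
    have hper : Function.IsPeriodicPt Θ p e := by
      rw [Function.IsPeriodicPt, ← AlgEquiv.coe_pow, hΘ]
      rfl
    exact ((Nat.dvd_prime hp).mp hper.minimalPeriod_dvd).resolve_left fun h =>
      hne (Function.minimalPeriod_eq_one_iff_isFixedPt.mp h)
  have hmove : ∀ k, 0 < k → k < p → (Θ ^ k) e ≠ e := by
    intro k hk hkp h
    have hper : Function.IsPeriodicPt Θ k e := by
      rw [Function.IsPeriodicPt, ← AlgEquiv.coe_pow]
      exact h
    have := hper.minimalPeriod_dvd
    rw [hmin] at this
    exact (Nat.le_of_dvd hk this).not_gt hkp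
  have horth0 : ∀ k, 0 < k → k < p → e * (Θ ^ k) e = 0 := by
    intro k hk hkp
    refine (hprim _ (hidem k) (hcent k)).resolve_right fun h1 => ?_
    have h2 := hprim _ (hidem (p - k)) (hcent (p - k))
    have h3 : (Θ ^ k) (e * (Θ ^ (p - k)) e) = (Θ ^ k) e * e := by
      rw [map_mul, ← AlgEquiv.mul_apply (Θ ^ k) (Θ ^ (p - k)), ← pow_add,
        Nat.add_sub_cancel' hkp.le, hΘ, AlgEquiv.one_apply]
    rw [← (hec _).eq, h1] at h3
    rcases h2 with h2 | h2
    · rw [h2, map_zero] at h3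
      exact he0 h3.symm
    · rw [h2] at h3
      exact hmove k hk hkp h3
  have horthlt : ∀ i j, i < j → j < p → (Θ ^ i) e * (Θ ^ j) e = 0 := by
    intro i j hij hj
    have := congrArg (Θ ^ i) (horth0 (j - i) (by omega) (by omega))
    rwa [map_mul, ← AlgEquiv.mul_apply (Θ ^ i) (Θ ^ (j - i)), ← pow_add,
      Nat.add_sub_cancel' hij.le, map_zero] at this
  have hρ0 : ∀ k : ℕ, ρ ((Θ ^ k) e) ≠ 0 := by
    intro k
    induction k with
    | zero => exact hρe
    | succ k ih =>
      intro h
      rw [pow_succ', AlgEquiv.mul_apply, hρ] at h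
      apply ih
      have h1 := congrArg (fun M => Y * M * X) h
      simp only [mul_zero, zero_mul] at h1
      rw [← h1]
      simp only [mul_assoc]
      rw [hYX, mul_one, ← mul_assoc, hYX, one_mul]
  refine hn.not_ge (Matrix.le_of_orthogonal_idempotents (fun i : Fin p => ρ ((Θ ^ (i : ℕ)) e))
    (fun i => hρ0 i) (fun i => ?_) (fun i j hij => ?_))
  · rw [← map_mul, (hidem i).eq]
  · rw [← map_mul]
    rcases lt_or_gt_of_ne hij with h | h
    · rw [horthlt i j h j.2, map_zero]
    · rw [(hcent i _).eq, horthlt j i h i.2, map_zero]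

/-! ### Blocks of a product of matrix algebras -/

section Blocks

variable {K R : Type*} [Field K] [Ring R] [Algebra K R] {m : ℕ} {d : Fin m → ℕ}

/-- The inclusion of the `i`-th block of an algebra isomorphic to a product of matrix algebras. -/
def blockIncl (Φ : R ≃ₐ[K] Π i, Matrix (Fin (d i)) (Fin (d i)) K) (i : Fin m) :
    Matrix (Fin (d i)) (Fin (d i)) K →ₗ[K] R :=
  Φ.symm.toLinearMap ∘ₗ LinearMap.single K (fun i => Matrix (Fin (d i)) (Fin (d i)) K) i

variable (Φ : R ≃ₐ[K] Π i, Matrix (Fin (d i)) (Fin (d i)) K) (i : Fin m)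

theorem apply_blockIncl (M : Matrix (Fin (d i)) (Fin (d i)) K) :
    Φ (blockIncl Φ i M) = Pi.single i M := Φ.apply_symm_apply _

theorem apply_blockIncl_self (M : Matrix (Fin (d i)) (Fin (d i)) K) :
    Φ (blockIncl Φ i M) i = M := by rw [apply_blockIncl, Pi.single_eq_same]

theorem blockIncl_mul (M N : Matrix (Fin (d i)) (Fin (d i)) K) :
    blockIncl Φ i (M * N) = blockIncl Φ i M * blockIncl Φ i N := by
  apply Φ.injective
  rw [map_mul Φ, apply_blockIncl, apply_blockIncl, apply_blockIncl, Pi.single_mul]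

theorem blockIncl_one_mul (r : R) : blockIncl Φ i 1 * r = blockIncl Φ i (Φ r i) := by
  apply Φ.injective
  rw [map_mul, apply_blockIncl, apply_blockIncl]
  ext j : 1
  rcases eq_or_ne j i with rfl | h
  · simp
  · simp [h]

theorem commute_blockIncl_one (r : R) : Commute (blockIncl Φ i 1) r := by
  apply Φ.injective
  rw [map_mul, map_mul, apply_blockIncl]
  ext j : 1
  rcases eq_or_ne j i with rfl | h
  · simp
  · simp [h]

theorem isIdempotentElem_blockIncl_one : IsIdempotentElem (blockIncl Φ i 1) := by
  rw [IsIdempotentElem, ← blockIncl_mul, one_mul]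

theorem sum_blockIncl_one : ∑ i, blockIncl Φ i 1 = 1 := by
  apply Φ.injective
  rw [map_sum, map_one]
  simp_rw [apply_blockIncl]
  exact Finset.univ_sum_single 1

theorem blockIncl_one_mul_central_idempotent (f : R) (hf : IsIdempotentElem f)
    (hfc : ∀ r, Commute f r) :
    blockIncl Φ i 1 * f = 0 ∨ blockIncl Φ i 1 * f = blockIncl Φ i 1 := by
  have hcomm : ∀ M, Commute (Φ f i) M := by
    intro M
    have := congrFun ((hfc (blockIncl Φ i M)).map Φ).eq i
    rwa [Pi.mul_apply, Pi.mul_apply, apply_blockIncl_self] at this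
  obtain ⟨c, hc⟩ := Matrix.exists_algebraMap_eq_of_commute hcomm
  have hidem : Φ f i * Φ f i = Φ f i := by
    rw [← Pi.mul_apply, ← map_mul, hf.eq]
  rw [blockIncl_one_mul, ← hc]
  by_cases hd : Nonempty (Fin (d i))
  · rw [← hc, ← map_mul] at hidem
    have h1 := FaithfulSMul.algebraMap_injective K _ hidem
    rcases (IsIdempotentElem.iff_eq_zero_or_one (p := c)).mp h1 with rfl | rfl
    · left; rw [map_zero, map_zero]
    · right; rw [map_one]
  · rw [not_nonempty_iff] at hd
    left
    rw [Subsingleton.elim (algebraMap K _ c) 0, map_zero]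

/-- Matrix algebras are simple, so `ρ` is injective on the block; compare dimensions `d i ^ 2 ≤ n ^
2`. -/
theorem le_of_apply_blockIncl_one_ne_zero {n : ℕ} (ρ : R →ₐ[K] Matrix (Fin n) (Fin n) K)
    (hρ : ρ (blockIncl Φ i 1) ≠ 0) : d i ≤ n := by
  have hinj : Function.Injective (ρ.toLinearMap ∘ₗ blockIncl Φ i) := by
    rw [← LinearMap.ker_eq_bot, LinearMap.ker_eq_bot']
    intro M hM
    by_contra hne
    have hM' : ρ (blockIncl Φ i M) = 0 := hM
    obtain ⟨a, b, hab⟩ : ∃ a b, M a b ≠ 0 := by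
      by_contra! h
      exact hne (Matrix.ext h)
    have hsingle : ∀ j, ρ (blockIncl Φ i (Matrix.single j j 1)) = 0 := by
      intro j
      have h1 : Matrix.single j j 1 =
          (M a b)⁻¹ • (Matrix.single j a 1 * M * Matrix.single b j 1) := by
        ext s t
        simp [Matrix.single_mul_mul_single, Matrix.single_apply, hab]
      rw [h1, map_smul, map_smul, blockIncl_mul, blockIncl_mul, map_mul, map_mul, hM', mul_zero,
        zero_mul, smul_zero]
    apply hρ
    have h2 : (1 : Matrix (Fin (d i)) (Fin (d i)) K) = ∑ j, Matrix.single j j 1 := by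
      rw [Matrix.sum_single_one]
    rw [h2, map_sum, map_sum]
    exact Finset.sum_eq_zero fun j _ => hsingle j
  have h := LinearMap.finrank_le_finrank_of_injective hinj
  simp only [Module.finrank_matrix, Fintype.card_fin, Module.finrank_self, mul_one] at h
  exact Nat.mul_self_le_mul_self_iff.mp h

theorem exists_stable_block {p n : ℕ} (hp : p.Prime) (hn : n < p) {Θ : R ≃ₐ[K] R}
    (hΘ : Θ ^ p = 1) (ρ : R →ₐ[K] Matrix (Fin n) (Fin n) K) {X Y : Matrix (Fin n) (Fin n) K}
    (hXY : X * Y = 1) (hρ : ∀ r, ρ (Θ r) = X * ρ r * Y) {r₀ : R} (hr₀ : ρ (Θ r₀) ≠ ρ r₀) :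
    ∃ i, d i ≤ n ∧ Θ (blockIncl Φ i 1) = blockIncl Φ i 1 ∧ Φ (Θ r₀) i ≠ Φ r₀ i := by
  obtain ⟨i, hi⟩ : ∃ i, ρ (blockIncl Φ i 1 * (Θ r₀ - r₀)) ≠ 0 := by
    by_contra! h
    apply hr₀
    rw [← sub_eq_zero, ← map_sub, ← one_mul (Θ r₀ - r₀), ← sum_blockIncl_one Φ, Finset.sum_mul,
      map_sum]
    exact Finset.sum_eq_zero fun i _ => h i
  have hρe : ρ (blockIncl Φ i 1) ≠ 0 := by
    intro h
    rw [map_mul, h, zero_mul] at hi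
    exact hi rfl
  refine ⟨i, le_of_apply_blockIncl_one_ne_zero Φ i ρ hρe, ?_, ?_⟩
  · exact Matrix.apply_eq_of_primitive_idempotent hp hn hΘ (isIdempotentElem_blockIncl_one Φ i)
      (commute_blockIncl_one Φ i) (blockIncl_one_mul_central_idempotent Φ i) ρ hXY hρ hρe
  · intro h
    rw [blockIncl_one_mul, map_sub, Pi.sub_apply, h, sub_self, map_zero, map_zero] at hi
    exact hi rfl

theorem exists_block_algEquiv {Θ : R ≃ₐ[K] R} (he : Θ (blockIncl Φ i 1) = blockIncl Φ i 1) :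
    ∃ τ : Matrix (Fin (d i)) (Fin (d i)) K ≃ₐ[K] Matrix (Fin (d i)) (Fin (d i)) K,
      (∀ r, Φ (Θ r) i = τ (Φ r i)) ∧ ∀ M, Θ (blockIncl Φ i M) = blockIncl Φ i (τ M) := by
  let f : Matrix (Fin (d i)) (Fin (d i)) K →ₐ[K] Matrix (Fin (d i)) (Fin (d i)) K :=
    AlgHom.ofLinearMap
      ((LinearMap.proj i) ∘ₗ Φ.toLinearMap ∘ₗ Θ.toLinearMap ∘ₗ blockIncl Φ i)
      (by
        change Φ (Θ (blockIncl Φ i 1)) i = 1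
        rw [he, apply_blockIncl_self])
      (fun M N => by
        change Φ (Θ (blockIncl Φ i (M * N))) i =
          Φ (Θ (blockIncl Φ i M)) i * Φ (Θ (blockIncl Φ i N)) i
        rw [blockIncl_mul, map_mul, map_mul, Pi.mul_apply])
  have hf : ∀ M, f M = Φ (Θ (blockIncl Φ i M)) i := fun M => rfl
  have hincl : ∀ M, Θ (blockIncl Φ i M) = blockIncl Φ i (f M) := by
    intro M
    have h1 := map_mul Θ (blockIncl Φ i 1) (blockIncl Φ i M)
    rw [← blockIncl_mul, one_mul, he] at h1
    rw [hf, ← blockIncl_one_mul, ← h1]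
  have hinj : Function.Injective f := by
    intro M N h
    have h1 : Θ (blockIncl Φ i M) = Θ (blockIncl Φ i N) := by rw [hincl, hincl, h]
    rw [← apply_blockIncl_self Φ i M, Θ.injective h1, apply_blockIncl_self]
  have hbij : Function.Bijective f :=
    ⟨hinj, (LinearMap.injective_iff_surjective (f := f.toLinearMap)).mp hinj⟩
  refine ⟨AlgEquiv.ofBijective f hbij, fun r => ?_, hincl⟩
  change Φ (Θ r) i = f (Φ r i)
  rw [hf, ← blockIncl_one_mul, map_mul, he, blockIncl_one_mul, apply_blockIncl_self]

end Blocks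

/-! ### The lower bound for the block degree -/

theorem Matrix.pow_eq_zero_of_isNilpotent {K : Type*} [Field K] {d : ℕ}
    {N : Matrix (Fin d) (Fin d) K} (hN : IsNilpotent N) : N ^ d = 0 := by
  have h1 := Matrix.isNilpotent_charpoly_sub_pow_of_isNilpotent hN
  have h2 : N.charpoly = Polynomial.X ^ d := by
    have := h1.eq_zero
    rw [Fintype.card_fin, sub_eq_zero] at this
    exact this
  have h3 := N.aeval_self_charpoly
  rwa [h2, map_pow, Polynomial.aeval_X] at h3

theorem Matrix.sub_one_pow_eq_zero {K : Type*} [Field K] {p : ℕ} (hp : p.Prime) [CharP K p]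
    {ι : Type*} [Fintype ι] [DecidableEq ι] {u : Matrix ι ι K} (hu : u ^ p = 1) :
    (u - 1) ^ p = 0 := by
  have : Fact p.Prime := ⟨hp⟩
  have h : ((Polynomial.X : Polynomial K) - 1) ^ p = Polynomial.X ^ p - 1 := by
    rw [sub_pow_char, one_pow]
  have := congrArg (Polynomial.aeval u) h
  simp only [map_pow, map_sub, Polynomial.aeval_X, map_one] at this
  rw [this, hu, sub_self]

theorem Matrix.exists_nilpotency_index {K : Type*} [Field K] {d : ℕ}
    {N : Matrix (Fin d) (Fin d) K} (hN : IsNilpotent N) (h0 : N ≠ 0) :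
    ∃ r, 2 ≤ r ∧ r ≤ d ∧ N ^ r = 0 ∧ N ^ (r - 1) ≠ 0 := by
  classical
  have hex : ∃ r, N ^ r = 0 := hN
  have hd := Nat.find_min' hex (Matrix.pow_eq_zero_of_isNilpotent hN)
  have h1 := Nat.find_spec hex
  have hr : 2 ≤ Nat.find hex := by
    by_contra! h
    interval_cases hr : Nat.find hex
    · rw [pow_zero] at h1
      exact h0 (by rw [← mul_one N, h1, mul_zero])
    · rw [pow_one] at h1
      exact h0 h1
  exact ⟨_, hr, hd, h1, Nat.find_min hex (by omega)⟩

theorem exists_span_eq_top_of_conj_ne {K S : Type*} [Field K] [IsAlgClosed K] [Group S] [Finite S]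
    {p n : ℕ} (hp : p.Prime) [CharP K p] (hpS : ¬ p ∣ Nat.card S) (hn : n < p) {σ : MulAut S}
    (hσ : σ ^ p = 1) (ρ : S →* Matrix (Fin n) (Fin n) K) {X Y : Matrix (Fin n) (Fin n) K}
    (hXY : X * Y = 1) (hρ : ∀ s, ρ (σ s) = X * ρ s * Y) {y : S} (hy : ρ (σ y) ≠ ρ y) :
    ∃ d : ℕ, p - 1 ≤ d ∧ d ≤ n ∧ 2 ≤ d ∧ ∃ π : S →* Matrix (Fin d) (Fin d) K,
      Submodule.span K (Set.range π) = ⊤ := by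
  have : NeZero (Nat.card S : K) := ⟨fun h => hpS ((CharP.cast_eq_zero_iff K p _).mp h)⟩
  have : IsSemisimpleRing (MonoidAlgebra K S) := inferInstance
  have : FiniteDimensional K (MonoidAlgebra K S) := inferInstance
  obtain ⟨m, d, hd, ⟨Φ⟩⟩ :=
    IsSemisimpleRing.exists_algEquiv_pi_matrix_of_isAlgClosed K (MonoidAlgebra K S)
  let Θ : MonoidAlgebra K S ≃ₐ[K] MonoidAlgebra K S := MonoidAlgebra.domCongrAut σ
  have hΘ : Θ ^ p = 1 := by rw [← map_pow, hσ, map_one]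
  have hΘs : ∀ s c, Θ (MonoidAlgebra.single s c) = MonoidAlgebra.single (σ s) c := fun s c =>
    MonoidAlgebra.domCongr_single σ s c
  have hΘc : ∀ (i : ℕ) r s, ((Θ ^ i) r).coeff s = r.coeff (((σ⁻¹) ^ i) s) := by
    intro i r s
    rw [← map_pow, inv_pow]
    exact MonoidAlgebra.coeff_domCongr (σ ^ i) r s
  let ρ' : MonoidAlgebra K S →ₐ[K] Matrix (Fin n) (Fin n) K := MonoidAlgebra.lift K _ S ρ
  have hρ's : ∀ s, ρ' (MonoidAlgebra.single s 1) = ρ s := fun s => by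
    rw [MonoidAlgebra.lift_single, one_smul]
  have hρ' : ∀ r, ρ' (Θ r) = X * ρ' r * Y := by
    intro r
    induction r using MonoidAlgebra.induction_linear with
    | zero => simp
    | add f g hf hg => rw [map_add, map_add, hf, hg, map_add, mul_add, add_mul]
    | single s c =>
      rw [hΘs, MonoidAlgebra.lift_single, MonoidAlgebra.lift_single, hρ, mul_smul_comm,
        smul_mul_assoc]
  obtain ⟨i, hdn, he, hne⟩ := exists_stable_block Φ hp hn hΘ ρ' hXY hρ'
    (r₀ := MonoidAlgebra.single y 1) (by rwa [hΘs, hρ's, hρ's])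
  obtain ⟨τ, hτ, hτincl⟩ := exists_block_algEquiv Φ i he
  have := hd i
  have hsurj : Function.Surjective fun r => Φ r i := fun M => ⟨_, apply_blockIncl_self Φ i M⟩
  have hτpow : ∀ (k : ℕ) M, (Θ ^ k) (blockIncl Φ i M) = blockIncl Φ i ((τ ^ k) M) := by
    intro k M
    induction k with
    | zero => rfl
    | succ k ih => rw [pow_succ', AlgEquiv.mul_apply, ih, hτincl, pow_succ', AlgEquiv.mul_apply]
  have hτp : τ ^ p = 1 := by
    ext1 M
    rw [← apply_blockIncl_self Φ i ((τ ^ p) M), ← hτpow, hΘ, AlgEquiv.one_apply,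
      apply_blockIncl_self, AlgEquiv.one_apply]
  obtain ⟨u, v, huv, hup, huτ⟩ := Matrix.exists_conj_pow_eq_one hp.ne_zero τ hτp
  have hvu : v * u = 1 := mul_eq_one_comm.mp huv
  have hnil : IsNilpotent (u - 1) := ⟨p, Matrix.sub_one_pow_eq_zero hp hup⟩
  have hu1 : u - 1 ≠ 0 := by
    intro h
    rw [sub_eq_zero] at h
    rw [h, one_mul] at huv
    rw [hτ, huτ, h, huv, one_mul, mul_one] at hne
    exact hne rfl
  obtain ⟨r, hr2, hrd, hr0, hr1⟩ := Matrix.exists_nilpotency_index hnil hu1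
  let π : S →* Matrix (Fin (d i)) (Fin (d i)) K :=
    (((Pi.evalAlgHom K (fun i => Matrix (Fin (d i)) (Fin (d i)) K) i).comp Φ.toAlgHom :
      MonoidAlgebra K S →ₐ[K] _) : MonoidAlgebra K S →* _).comp (MonoidAlgebra.of K S)
  have hπ : ∀ s, π s = Φ (MonoidAlgebra.single s 1) i := fun s => rfl
  have hΦ : ∀ r, Φ r i = ∑ᶠ s, r.coeff s • π s := by
    intro r
    have := Fintype.ofFinite S
    have h : (Pi.evalAlgHom K (fun i => Matrix (Fin (d i)) (Fin (d i)) K) i).comp Φ.toAlgHom =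
        MonoidAlgebra.lift K _ S π :=
      ((MonoidAlgebra.lift K _ S).apply_symm_apply _).symm
    rw [finsum_eq_sum_of_fintype]
    refine (congrArg (fun f => f r) h).trans ?_
    simp only [MonoidAlgebra.lift_apply]
    exact Finsupp.sum_fintype _ _ fun s => zero_smul _ _
  refine ⟨d i, ?_, hdn, hr2.trans hrd, π, ?_⟩
  -- Now `r ≤ d i ≤ p - 2`, which is what the choice of `c` requires.
  · by_contra hlt
    obtain ⟨c, hc0, hctr⟩ := exists_sum_conj_eq_zero_trace_ne_zero hp huv hr2 (by omega) hr0 hr1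
    have huvpow : ∀ (k : ℕ) M, (τ ^ k) M = u ^ k * M * v ^ k := by
      intro k
      induction k with
      | zero => intro M; simp
      | succ k ih =>
        intro M
        rw [pow_succ', AlgEquiv.mul_apply, ih, huτ, pow_succ', pow_succ]
        simp only [mul_assoc]
    have hcomm : Commute (u - 1) u := (Commute.refl u).sub_left (Commute.one_left u)
    have hπσ : ∀ s, π (σ s) = u * π s * v := fun s => by rw [hπ, ← hΘs, hτ, huτ, hπ]
    -- The inverse appears because `Θ` moves the coefficient at `σ⁻¹ s` to `s`.
    let P : Equiv.Perm S := MulAut.toPerm S σ⁻¹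
    have hPp : P ^ p = 1 := by rw [← map_pow, inv_pow, hσ, inv_one, map_one]
    have hl : ∀ s, Matrix.trace ((u - 1) * π (σ s)) = Matrix.trace ((u - 1) * π s) := by
      intro s
      have h1 : v * (u - 1) * u = u - 1 := by
        rw [mul_assoc, hcomm.eq, ← mul_assoc, hvu, one_mul]
      rw [hπσ, ← mul_assoc, Matrix.trace_mul_comm, ← mul_assoc, ← mul_assoc, h1]
    have key := sum_mul_eq_zero_of_sum_pow_apply_eq_zero (K := K) hp hPp
      (l := fun s => Matrix.trace ((u - 1) * π s)) (c := fun s => (blockIncl Φ i c).coeff s)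
      (fun s => by
        have := hl (σ⁻¹ s)
        rw [MulAut.apply_inv_self] at this
        exact this.symm) (fun s hs => ?_) (fun s => ?_)
    · apply hctr
      rw [← apply_blockIncl_self Φ i c, hΦ, ← key]
      have := Fintype.ofFinite S
      rw [finsum_eq_sum_of_fintype, finsum_eq_sum_of_fintype, Finset.mul_sum, Matrix.trace_sum]
      refine Finset.sum_congr rfl fun s _ => ?_
      rw [mul_smul_comm, Matrix.trace_smul, smul_eq_mul, mul_comm]
    · have hs' : σ s = s := by
        have h1 : σ⁻¹ s = s := hs
        conv_lhs => rw [← h1]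
        exact MulAut.apply_inv_self S σ s
      have h1 := hπσ s
      rw [hs'] at h1
      have h2 : Commute u (π s) := by
        rw [Commute, SemiconjBy]
        nth_rw 2 [h1]
        rw [mul_assoc, hvu, mul_one]
      have h3 : Commute (u - 1) (π s) := h2.sub_left (Commute.one_left _)
      exact (Matrix.isNilpotent_trace_of_isNilpotent (h3.isNilpotent_mul_right hnil)).eq_zero
    · have h1 : ∑ k ∈ Finset.range p, (Θ ^ k) (blockIncl Φ i c) = 0 := by
        simp_rw [hτpow, huvpow]
        rw [← map_sum, hc0, map_zero]
      have h2 := congrArg (fun r => r.coeff s) h1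
      simp only [MonoidAlgebra.coeff_sum, Finsupp.finsetSum_apply, hΘc] at h2
      have hPk : ∀ k, (P ^ k) s = (σ⁻¹ ^ k) s := fun k => by
        rw [← map_pow]
        rfl
      simp only [hPk]
      exact h2
  · rw [eq_top_iff]
    intro M _
    obtain ⟨r, rfl⟩ := hsurj M
    have := Fintype.ofFinite S
    change Φ r i ∈ _
    rw [hΦ, finsum_eq_sum_of_fintype]
    exact Submodule.sum_mem _ fun s _ => Submodule.smul_mem _ _ (Submodule.subset_span ⟨s, rfl⟩)

/-! ### Fermat primes and the conclusion -/

theorem isFermatPrime_of_sub_one_dvd_pow {p q e : ℕ} (hp : p.Prime) (hp2 : 3 ≤ p) (hq : q.Prime)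
    (h : p - 1 ∣ q ^ e) : IsFermatPrime p := by
  obtain ⟨a, _, ha⟩ := (Nat.dvd_prime_pow hq).mp h
  have hodd : Odd p := hp.odd_of_ne_two (by omega)
  have h2 : 2 ∣ q ^ a := by
    rw [← ha]
    exact (Nat.Odd.sub_odd hodd odd_one).two_dvd
  have hq2 : 2 = q := (Nat.prime_dvd_prime_iff_eq Nat.prime_two hq).mp
    (Nat.prime_two.dvd_of_dvd_pow h2)
  subst hq2
  have hpa : p = 2 ^ a + 1 := by omega
  have ha0 : a ≠ 0 := by
    rintro rfl
    omega
  obtain ⟨m, hm⟩ := Nat.pow_of_pow_add_prime one_lt_two ha0 (hpa ▸ hp)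
  exact ⟨hp, m, by rw [hpa, hm, Nat.fermatNumber]⟩

theorem dvd_card_of_matrix_span_eq_top {K S : Type*} [Field K] [IsAlgClosed K] [Group S] [Finite S]
    {q : ℕ} (hq : q.Prime) (hS : IsPGroup q S) {d : ℕ} (hd : d ≠ 0)
    (π : S →* Matrix (Fin d) (Fin d) K) (hπ : Submodule.span K (Set.range π) = ⊤) :
    d ∣ Nat.card S := by
  have : NeZero d := ⟨hd⟩
  let L : Matrix (Fin d) (Fin d) K ≃ₐ[K] Module.End K (Fin d → K) := Matrix.toLinAlgEquiv'
  have h := finrank_dvd_card_of_span_eq_top (K := K) hq S hS (Fin d → K)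
    ((L : Matrix (Fin d) (Fin d) K →* Module.End K (Fin d → K)).comp π) (by
      have h1 : Set.range ((L : Matrix (Fin d) (Fin d) K →* Module.End K (Fin d → K)).comp π) =
          L.toLinearMap '' Set.range π := by
        rw [← Set.range_comp]
        rfl
      rw [h1, Submodule.span_image, hπ, Submodule.map_top, LinearMap.range_eq_top]
      exact L.surjective)
  rwa [Module.finrank_fin_fun] at h

theorem exists_mulAut_conj {G : Type*} [Group G] {S : Subgroup G} [Finite S] {x : G}
    (h : ∀ s ∈ S, x * s * x⁻¹ ∈ S) {p : ℕ} (hx : x ^ p = 1) :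
    ∃ σ : MulAut S, σ ^ p = 1 ∧ ∀ s, (σ s : G) = x * s * x⁻¹ := by
  let f : S →* S :=
    { toFun := fun s => ⟨x * s * x⁻¹, h s s.2⟩
      map_one' := Subtype.ext (by simp)
      map_mul' := fun s t => Subtype.ext (by simp) }
  have hinj : Function.Injective f := fun s t hst => by
    have : x * s * x⁻¹ = x * t * x⁻¹ := congrArg Subtype.val hst
    exact Subtype.ext (by simpa using this)
  let σ : MulAut S := MulEquiv.ofBijective f (Finite.injective_iff_bijective.mp hinj)
  have hσ : ∀ s, (σ s : G) = x * s * x⁻¹ := fun s => rfl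
  have hpow : ∀ (i : ℕ) s, (((σ ^ i) s : S) : G) = x ^ i * s * (x ^ i)⁻¹ := by
    intro i s
    induction i with
    | zero => simp
    | succ i ih =>
      rw [pow_succ', MulAut.mul_apply, hσ, ih, pow_succ', mul_inv_rev]
      simp only [mul_assoc]
  refine ⟨σ, MulEquiv.ext fun s => Subtype.ext ?_, hσ⟩
  rw [hpow, hx, one_mul, inv_one, mul_one]
  rfl

theorem naturalRep_injective {k : Type*} [Field k] {n : ℕ}
    (G : Subgroup (Matrix.GeneralLinearGroup (Fin n) k)) : Function.Injective (naturalRep G) := by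
  intro g h hgh
  exact Subtype.ext (Units.ext (Matrix.toLinAlgEquiv'.injective hgh))

theorem corollary4p2 {k : Type*} [Field k] (p : ℕ) (hp : p.Prime) [CharP k p] (n : ℕ)
    (G : Subgroup (Matrix.GeneralLinearGroup (Fin n) k)) [Finite G]
    (hcr : IsCompletelyReducible G) (hsolv : IsPSolvable p G) (hdvd : p ∣ Nat.card G) :
    p ≤ n ∨ (n = p - 1 ∧ IsFermatPrime p) := by
  have : Fact p.Prime := ⟨hp⟩
  rw [or_iff_not_imp_left, not_le]
  intro hn
  have hss : (naturalRep G).IsSemisimpleRepresentation := hcr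
  obtain ⟨Q, hQn, hQp, hQC⟩ := exists_normal_centralizer_le hp hsolv fun P hPn hP =>
    Representation.eq_bot_of_isPGroup_of_normal hp (naturalRep G) (naturalRep_injective G) P hPn hP
  obtain ⟨x, hx⟩ := exists_prime_orderOf_dvd_card' p hdvd
  have hxQ : x ∉ Subgroup.centralizer (Q : Set G) := by
    intro h
    apply hQp
    rw [← hx, ← Subgroup.orderOf_mk x (hQC h)]
    exact orderOf_dvd_natCard _
  obtain ⟨q, hq, S, hSQ, hS, hxS, y, hyS, hxy⟩ := exists_isPGroup_conj_ne hp hx hQn hQp hxQ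
  obtain ⟨σ, hσp, hσ⟩ := exists_mulAut_conj hxS (hx ▸ pow_orderOf_eq_one x)
  let K := AlgebraicClosure k
  have : CharP K p := charP_of_injective_algebraMap (algebraMap k K).injective p
  let F : G →* Matrix (Fin n) (Fin n) K :=
    ((algebraMap k K).mapMatrix (m := Fin n)).toMonoidHom.comp
      ((Units.coeHom _).comp G.subtype)
  have hF : Function.Injective F := fun g h hgh =>
    Subtype.ext (Units.ext (Matrix.map_injective (algebraMap k K).injective hgh))
  obtain ⟨d, hpd, hdn, hd2, π, hπ⟩ := exists_span_eq_top_of_conj_ne (K := K) hp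
    (fun h => hQp (h.trans (Subgroup.card_dvd_of_le hSQ))) hn hσp (F.comp S.subtype)
    (X := F x) (Y := F x⁻¹) (by rw [← map_mul, mul_inv_cancel, map_one])
    (fun s => by
      change F (σ s) = F x * F s * F x⁻¹
      rw [hσ, map_mul, map_mul]) (y := ⟨y, hyS⟩) (fun h => hxy (by
        have := hF h
        rwa [Subgroup.coe_subtype, hσ] at this))
  have : Fact q.Prime := ⟨hq⟩
  obtain ⟨e, he⟩ := IsPGroup.iff_card.mp hS
  have hdS := dvd_card_of_matrix_span_eq_top hq hS (by omega) π hπ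
  -- From `p - 1 ≤ d ≤ n < p`; moreover `2 ≤ d` excludes `p = 2`.
  have hdp : d = p - 1 := by omega
  rw [he, hdp] at hdS
  exact ⟨by omega, isFermatPrime_of_sub_one_dvd_pow hp (by omega) hq hdS⟩
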